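/- Let $k$ be a field, $X$ a finite set, and $\deg : X \to \mathbb{R}_{>0}$ an arbitrary function; give a word in $X$ the sum of the degrees of its letters. Let $F$ be either the free algebra $k\langle X\rangle$ or the completed free algebra $k\langle\langle X\rangle\rangle$ (formal power series in the noncommuting variables $X$). For $\alpha\in\mathbb{R}$ let $F_\alpha$ be the space of all (in the completed case, possibly infinite) linear combinations of words of degree at least $\alpha$, and for $r \in F$ put $\deg r = \sup\{\alpha : r \in F_\alpha\}$, so $\deg 0=+\infty$. Let $R \subset F$ be a set of elements of positive degree (i.e. with zero constant term) such that for each real $\alpha>0$ only finitely many elements of $R$ have degree $\alpha$. Let $A$ be the quotient of $F$ by the two-sided ideal generated by $R$ (in the completed case, by the closure of this ideal in the topology of the filtration $F_\alpha$), let $A_\alpha$ be the image of $F_\alpha$ in $A$, and put $$H_A(z)=\sum_{\alpha\ge 0} z^\alpha \dim_k\Bigl(A_\alpha\big/\bigcup_{\beta>\alpha}A_\beta\Bigr),\qquad f_A(z) = 1-\sum_{x\in X} z^{\deg x}+\sum_{r\in R} z^{\deg r},$$ where $z^{+\infty}=0$, and a divergent series with nonnegative terms has the value $+\infty$. Then $$f_A(z_0)\,H_A(z_0)\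 \ge\ 1\qquad\text{for all real } z_0\in[0,1],$$ where $+\infty$ counts as $>1$: the inequality is regarded as satisfied when $H_A(z_0)=+\infty$, and if $H_A(z_0)<+\infty$, then either $f_A(z_0)=+\infty$ or $f_A(z_0)$ is finite and the inequality holds between real numbers. -/

import Mathlib

open scoped ENNReal NNReal

namespace GolodShafarevich

/-- The total degree of a word in the generators. -/
def wordDeg {X : Type*} (d : X → ℝ) (w : List X) : ℝ := (w.map d).sum

/-- The completed free algebra `k⟨⟨X⟩⟩`: formal power series in the noncommuting variables `X`,
given by the coefficient of each word. -/
@[ext]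
structure NCSeries (k : Type*) (X : Type*) where
  /-- the coefficient of a word -/
  coeff : List X → k

namespace NCSeries

variable {k : Type*} {X : Type*}

section Ring

variable [CommRing k]

instance : Zero (NCSeries k X) := ⟨⟨fun _ => 0⟩⟩
instance : One (NCSeries k X) := ⟨⟨fun w => if w.length = 0 then 1 else 0⟩⟩
instance : Add (NCSeries k X) := ⟨fun f g => ⟨fun w => f.coeff w + g.coeff w⟩⟩
instance : Neg (NCSeries k X) := ⟨fun f => ⟨fun w => -f.coeff w⟩⟩
instance : Sub (NCSeries k X) := ⟨fun f g => ⟨fun w => f.coeff w - g.coeff w⟩⟩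
instance : SMul k (NCSeries k X) := ⟨fun c f => ⟨fun w => c * f.coeff w⟩⟩

/-- The Cauchy product: the coefficient of `w` is the sum over all factorizations `w = u ++ v`. -/
instance : Mul (NCSeries k X) :=
  ⟨fun f g => ⟨fun w => ∑ p ∈ Finset.HasAntidiagonal.antidiagonal w.length,
    f.coeff (w.take p.1) * g.coeff (w.drop p.1)⟩⟩

@[simp] theorem coeff_zero (w : List X) : (0 : NCSeries k X).coeff w = 0 := rfl
@[simp] theorem coeff_one (w : List X) :
    (1 : NCSeries k X).coeff w = if w.length = 0 then 1 else 0 := rfl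
@[simp] theorem coeff_add (f g : NCSeries k X) (w : List X) :
    (f + g).coeff w = f.coeff w + g.coeff w := rfl
@[simp] theorem coeff_neg (f : NCSeries k X) (w : List X) : (-f).coeff w = -f.coeff w := rfl
@[simp] theorem coeff_sub (f g : NCSeries k X) (w : List X) :
    (f - g).coeff w = f.coeff w - g.coeff w := rfl
@[simp] theorem coeff_smul (c : k) (f : NCSeries k X) (w : List X) :
    (c • f).coeff w = c * f.coeff w := rfl
theorem coeff_mul (f g : NCSeries k X) (w : List X) :
    (f * g).coeff w = ∑ p ∈ Finset.HasAntidiagonal.antidiagonal w.length,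
      f.coeff (w.take p.1) * g.coeff (w.drop p.1) := rfl

protected theorem one_mul' (f : NCSeries k X) : 1 * f = f := by
  ext w
  rw [coeff_mul, Finset.sum_eq_single (0, w.length)]
  · simp
  · rintro ⟨a, b⟩ hab hne
    have h : a + b = w.length := by simpa using hab
    have ha : a ≠ 0 := by
      rintro rfl
      exact hne (by simp at h; simp [h])
    have : (w.take a).length ≠ 0 := by rw [List.length_take]; omega
    rw [coeff_one, if_neg this, zero_mul]
  · intro h; simp at h

protected theorem mul_one' (f : NCSeries k X) : f * 1 = f := by
  ext w
  rw [coeff_mul, Finset.sum_eq_single (w.length, 0)]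
  · simp
  · rintro ⟨a, b⟩ hab hne
    have h : a + b = w.length := by simpa using hab
    have hb : b ≠ 0 := by
      rintro rfl
      exact hne (by simp at h; simp [h])
    have : (w.drop a).length ≠ 0 := by rw [List.length_drop]; omega
    rw [coeff_one, if_neg this, mul_zero]
  · intro h; simp at h

protected theorem mul_assoc' (f g h : NCSeries k X) : f * g * h = f * (g * h) := by
  ext w
  simp only [coeff_mul, Finset.sum_mul, Finset.mul_sum]
  rw [Finset.sum_sigma', Finset.sum_sigma']
  refine Finset.sum_bij'
    (fun x _ => ⟨(x.2.1, x.2.2 + x.1.2), (x.2.2, x.1.2)⟩)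
    (fun x _ => ⟨(x.1.1 + x.2.1, x.2.2), (x.1.1, x.2.1)⟩) ?_ ?_ ?_ ?_ ?_
  · rintro ⟨⟨a, b⟩, c, e⟩ hx
    simp at hx ⊢
    omega
  · rintro ⟨⟨a, b⟩, c, e⟩ hx
    simp at hx ⊢
    omega
  · rintro ⟨⟨a, b⟩, c, e⟩ hx
    simp at hx ⊢
    omega
  · rintro ⟨⟨a, b⟩, c, e⟩ hx
    simp at hx ⊢
    omega
  · rintro ⟨⟨a, b⟩, c, e⟩ hx
    simp at hx
    obtain ⟨h1, h2⟩ := hx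
    have h3 : c + e = a := by omega
    subst h3
    simp only [List.take_take, List.drop_drop, List.drop_take]
    rw [Nat.min_eq_left (by omega), Nat.add_sub_cancel_left]
    ring

instance : Ring (NCSeries k X) where
  add_assoc f g h := by ext w; simp [add_assoc]
  zero_add f := by ext w; simp
  add_zero f := by ext w; simp
  add_comm f g := by ext w; simp [add_comm]
  left_distrib f g h := by ext w; simp [coeff_mul, mul_add, Finset.sum_add_distrib]
  right_distrib f g h := by ext w; simp [coeff_mul, add_mul, Finset.sum_add_distrib]
  zero_mul f := by ext w; simp [coeff_mul]
  mul_zero f := by ext w; simp [coeff_mul]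
  mul_assoc := NCSeries.mul_assoc'
  one_mul := NCSeries.one_mul'
  mul_one := NCSeries.mul_one'
  neg_add_cancel f := by ext w; simp
  sub_eq_add_neg f g := by ext w; simp [sub_eq_add_neg]
  nsmul := nsmulRec
  zsmul := zsmulRec

instance : Module k (NCSeries k X) where
  one_smul f := by ext w; simp
  mul_smul a b f := by ext w; simp [mul_assoc]
  smul_zero a := by ext w; simp
  smul_add a f g := by ext w; simp [mul_add]
  add_smul a b f := by ext w; simp [add_mul]
  zero_smul f := by ext w; simp

instance : Algebra k (NCSeries k X) :=
  Algebra.ofModule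
    (fun c f g => by ext w; simp [coeff_mul, Finset.mul_sum, mul_assoc])
    (fun c f g => by ext w; simp [coeff_mul, Finset.mul_sum, mul_left_comm])

end Ring

end NCSeries

section Filtrations

variable {k : Type*} [Field k] {X : Type*}

/-- The descending filtration of the free algebra `k⟨X⟩`: linear combinations of words of degree
at least `α`. -/
def freeFil (d : X → ℝ) (α : ℝ) : Submodule k (FreeAlgebra k X) :=
  Submodule.span k {f | ∃ w : List X, α ≤ wordDeg d w ∧ f = (w.map (FreeAlgebra.ι k)).prod}

/-- The descending filtration of the completed free algebra `k⟨⟨X⟩⟩`: (infinite) linear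
combinations of words of degree at least `α`. -/
def seriesFil (d : X → ℝ) (α : ℝ) : Submodule k (NCSeries k X) where
  carrier := {f | ∀ w : List X, wordDeg d w < α → f.coeff w = 0}
  zero_mem' := fun _ _ => rfl
  add_mem' := fun {f g} hf hg w hw => by simp [hf w hw, hg w hw]
  smul_mem' := fun c f hf w hw => by simp [hf w hw]

variable {F : Type*} [Ring F] [Algebra k F] {A : Type*} [Ring A] [Algebra k A]

/-- The filtration on `A` induced through `π : F → A`: `A_α` consists of the elements that are
linear combinations of products of the generators of total degree at least `α`. -/
def inducedFil (fil : ℝ → Submodule k F) (π : F →ₐ[k] A) (α : ℝ) : Submodule k A :=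
  (fil α).map π.toLinearMap

/-- The degree of an element of a filtered algebra, `deg x ≥ α` iff `x` lies in the `α`-th term;
in particular `deg 0 = +∞`. -/
noncomputable def filDeg (fil : ℝ → Submodule k F) (x : F) : EReal :=
  sSup {a : EReal | ∃ α : ℝ, a = (α : EReal) ∧ x ∈ fil α}

/-- The dimension of `A_α / ⋃_{β > α} A_β`, in `[0, ∞]` (the union is that of a chain). -/
noncomputable def grDim (fil : ℝ → Submodule k A) (α : ℝ) : ℝ≥0∞ :=
  ((Cardinal.toENat (Module.rank k
    (fil α ⧸ (⨆ β : ℝ, ⨆ _ : α < β, fil β).comap (fil α).subtype)) : ℕ∞) : ℝ≥0∞)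

/-- The value at `z ∈ [0, 1]` of the Hilbert series
`∑_{α ≥ 0} dim (A_α / ⋃_{β > α} A_β) z ^ α`. It is `⊤` iff the series diverges at `z`. -/
noncomputable def hilbertSeries (fil : ℝ → Submodule k A) (z : ℝ) : ℝ≥0∞ :=
  ∑' α : ℝ≥0, grDim fil α * ENNReal.ofReal (z ^ (α : ℝ))

/-- `z ^ a` for a degree `a`, where `z ^ (+∞) = 0`. -/
noncomputable def degPow (z : ℝ) (a : EReal) : ℝ≥0∞ :=
  if a = ⊤ then 0 else ENNReal.ofReal (z ^ a.toReal)

/-- The value at `z ∈ [0, 1]` of `H_R(z) = ∑_{r ∈ R} z ^ (deg r)`. -/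
noncomputable def relSeries (fil : ℝ → Submodule k F) (R : Set F) (z : ℝ) : ℝ≥0∞ :=
  ∑' r : R, degPow z (filDeg fil (r : F))

/-- The value `f_A(z) = 1 - H_X(z) + H_R(z)`, which is `+∞` iff `H_R(z)` diverges. -/
noncomputable def gsSeries [Fintype X] (d : X → ℝ) (fil : ℝ → Submodule k F) (R : Set F)
    (z : ℝ) : EReal :=
  1 - ((∑ x : X, z ^ d x : ℝ) : EReal) + ((relSeries fil R z : ℝ≥0∞) : EReal)

/-- `R` is a discrete set of relations of positive degree: finitely many of each degree, and
none of them involves the empty word. -/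
def IsDiscreteRelations (fil : ℝ → Submodule k F) (R : Set F) : Prop :=
  (∀ r ∈ R, 0 < filDeg fil r) ∧
    ∀ α : ℝ, 0 < α → {r ∈ R | filDeg fil r = (α : EReal)}.Finite

/-- `A = k⟨X | R⟩`: `π` identifies `A` with the quotient of the free algebra by the two-sided
ideal generated by `R`. -/
def IsPresentation (π : FreeAlgebra k X →ₐ[k] A) (R : Set (FreeAlgebra k X)) : Prop :=
  Function.Surjective π ∧ ∀ f, π f = 0 ↔ f ∈ TwoSidedIdeal.span R

/-- `A` is the completed algebra `k⟨⟨X | R⟩⟩`: `π` identifies `A` with the quotient of the completed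
free algebra by the closure (in the topology of the filtration) of the two-sided ideal generated
by `R`. -/
def IsCompletedPresentation (d : X → ℝ) (π : NCSeries k X →ₐ[k] A) (R : Set (NCSeries k X)) :
    Prop :=
  Function.Surjective π ∧
    ∀ f, π f = 0 ↔ ∀ α : ℝ, ∃ g ∈ TwoSidedIdeal.span R, f - g ∈ seriesFil d α

/-- The inequality `f * H ≥ 1` between values of series, where the product counts as `+∞` (hence
as `> 1`) as soon as the Hilbert series diverges. If `H ≠ ⊤` and `f = ⊤`, then the product in
`EReal` is `⊤` unless `H = 0`. -/
def GSInequality (f : EReal) (H : ℝ≥0∞) : Prop :=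
  H = ⊤ ∨ 1 ≤ f * (H : EReal)

end Filtrations

end GolodShafarevich

/-!
The proof is Vinberg's argument, carried out modulo each term of the filtration.

Let `I` be the two-sided ideal generated by `R` and let `D t` be the codimension of `A_t` in `A`.
For the free algebra and for its completion alike, `A / A_t = F / (I + F_t)`, because closing `I`
adds nothing modulo `F_t`. The augmentation ideal of `F` is the free right module on the letters,
with coordinates the left derivatives `∂ₓ` (deletion of a leading letter `x`). The product rule
`∂ₓ (f * g) = ∂ₓ f * g + ε f • ∂ₓ g` gives, for `f ∈ I`, that `(∂ₓ f)ₓ` is a right linear combination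
of the vectors `(∂ₓ r)ₓ`, `r ∈ R`, modulo `I` (`WordCalculus.deriv_mem_of_mem_span`). Hence for
`t > 0` the sequence
`⨁_r A / A_{t - deg r} → ⨁_x A / A_{t - deg x} → A / A_t` is exact in the middle, and its last map
misses `1`; only the finitely many `r` of degree below `t` matter. Counting dimensions
(`WordCalculus.one_add_sum_finrank_le`),
`1 + ∑ₓ D (t - deg x) ≤ D t + ∑ᵣ D (t - deg r)`.

The degrees of words are finite in number below every bound, so `D t` is the sum of the dimensions
of the graded components of degree `< t` (`IsDiscreteFiltration.codim_eq_tsum`). Therefore, for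
`0 < z < 1`, integrating `D` against `-log z * z ^ t` gives `H_A z`, and translating `D` by `a`
multiplies the integral by `z ^ a`; the inequality above becomes
`1 + (∑ₓ z ^ deg x) * H_A z ≤ H_A z + (∑ᵣ z ^ deg r) * H_A z`
(`WordCalculus.series_inequality`). At `z = 1` the same follows by letting `t → ∞`, and at `z = 0`
from `A_0 ≠ A_δ` for small `δ > 0`. All of this takes place in `[0, ∞]`; the subtraction in `f_A` is
restored at the end (`gsInequality_of_le`).
-/

namespace GolodShafarevich

/-! ### Codimensions of a filtration with discrete jumps -/

section Filtration

variable {k : Type*} [Field k]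

/-- Beyond any `α` there is an interval free of elements of `S`. -/
theorem exists_gap {S : Set ℝ} (hS : ∀ t : ℝ, (S ∩ Set.Iio t).Finite) (α : ℝ) :
    ∃ β, α < β ∧ ∀ s ∈ S, α < s → β ≤ s := by
  rcases (S ∩ Set.Iio (α + 1) ∩ Set.Ioi α).eq_empty_or_nonempty with h | h
  · refine ⟨α + 1, by linarith, fun s hs hαs => ?_⟩
    by_contra hlt
    exact (h ▸ ⟨⟨hs, not_le.1 hlt⟩, hαs⟩ : s ∈ (∅ : Set ℝ))
  · obtain ⟨β, hβ, hmin⟩ := ((hS (α + 1)).inter_of_left (Set.Ioi α)).exists_minimalFor id _ h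
    refine ⟨β, hβ.2, fun s hs hαs => ?_⟩
    by_contra hlt
    have hsβ : s < β := not_le.1 hlt
    have := hmin (j := s) ⟨⟨hs, hsβ.trans hβ.1.2⟩, hαs⟩ hsβ.le
    exact hlt this

variable {V : Type*} [Ring V] [Algebra k V]

/-- A descending filtration of an algebra by subspaces of finite codimension, starting at degree
`0`, whose jumps lie in a set `S` of real numbers that is finite below every bound. The term
`G α` thus depends only on the elements of `S` that are at least `α`. -/
structure IsDiscreteFiltration (S : Set ℝ) (G : ℝ → Submodule k V) : Prop where
  finite_jumps : ∀ t : ℝ, (S ∩ Set.Iio t).Finite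
  le_of_jumps : ∀ α β : ℝ, (∀ s ∈ S, α ≤ s → β ≤ s) → G α ≤ G β
  eq_top : ∀ α : ℝ, α ≤ 0 → G α = ⊤
  finite_codim : ∀ α : ℝ, FiniteDimensional k (V ⧸ G α)

/-- The codimension of the `α`-th term of a filtration. -/
noncomputable def codim (G : ℝ → Submodule k V) (α : ℝ) : ℕ := Module.finrank k (V ⧸ G α)

theorem finrank_quotient_add_of_le {M : Type*} [AddCommGroup M] [Module k M] {P Q : Submodule k M}
    (h : P ≤ Q) [FiniteDimensional k (M ⧸ P)] :
    FiniteDimensional k (Q ⧸ P.comap Q.subtype) ∧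
    Module.finrank k (M ⧸ P) =
      Module.finrank k (M ⧸ Q) + Module.finrank k (Q ⧸ P.comap Q.subtype) := by
  have e1 := Submodule.quotientQuotientEquivQuotient P Q h
  have hker : P.comap Q.subtype = LinearMap.ker (P.mkQ ∘ₗ Q.subtype) := by
    rw [LinearMap.ker_comp, Submodule.ker_mkQ]
  have hrange : LinearMap.range (P.mkQ ∘ₗ Q.subtype) = Q.map P.mkQ := by
    rw [LinearMap.range_comp, Submodule.range_subtype]
  have e2 : (Q ⧸ P.comap Q.subtype) ≃ₗ[k] Q.map P.mkQ :=
    (Submodule.quotEquivOfEq _ _ hker).trans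
      ((LinearMap.quotKerEquivRange _).trans (LinearEquiv.ofEq _ _ hrange))
  refine ⟨Module.Finite.equiv e2.symm, ?_⟩
  rw [e2.finrank_eq, ← e1.finrank_eq, Submodule.finrank_quotient_add_finrank]

namespace IsDiscreteFiltration

variable {S : Set ℝ} {G : ℝ → Submodule k V} (hG : IsDiscreteFiltration S G)
include hG

theorem antitone : Antitone G := fun _ _ h => hG.le_of_jumps _ _ fun _ _ => h.trans

theorem codim_mono : Monotone (codim G) := fun α β h => by
  have := hG.finite_codim β
  have := (finrank_quotient_add_of_le (hG.antitone h)).2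
  unfold codim
  omega

theorem codim_of_nonpos {α : ℝ} (hα : α ≤ 0) : codim G α = 0 := by
  unfold codim
  rw [hG.eq_top α hα]
  exact Module.finrank_zero_of_subsingleton

/-- When there is no jump strictly between `α` and `β`, the term `G β` is the union of all terms
beyond `α`, so that it measures the graded component of degree `α`. -/
theorem codim_eq_add_grDim {α β : ℝ} (hαβ : α < β) (hgap : ∀ s ∈ S, α < s → β ≤ s) :
    (codim G β : ℝ≥0∞) = codim G α + grDim G α := by
  have hsup : (⨆ γ : ℝ, ⨆ _ : α < γ, G γ) = G β :=
    le_antisymm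
      (iSup₂_le fun γ hγ => hG.le_of_jumps _ _ fun s hs hγs => hgap s hs (hγ.trans_le hγs))
      (le_iSup₂_of_le β hαβ le_rfl)
  have := hG.finite_codim β
  obtain ⟨hfin, heq⟩ := finrank_quotient_add_of_le (hG.antitone hαβ.le)
  unfold grDim codim
  rw [hsup, heq, ← Module.finrank_eq_rank, map_natCast]
  simp

theorem grDim_eq_zero {α : ℝ} (hα : α ∉ S) : grDim G α = 0 := by
  obtain ⟨β, hαβ, hgap⟩ := exists_gap hG.finite_jumps α
  have h := hG.codim_eq_add_grDim hαβ hgap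
  have heq : G α = G β := le_antisymm
    (hG.le_of_jumps _ _ fun s hs hαs => hgap s hs (hαs.lt_of_ne fun h => hα (h ▸ hs)))
    (hG.antitone hαβ.le)
  have hc : codim G α = codim G β := by unfold codim; rw [heq]
  rw [hc] at h
  exact (ENNReal.add_right_inj (a := (codim G β : ℝ≥0∞)) (by simp)).1 (by rw [← h, add_zero])

theorem countable_support_grDim : {β : ℝ≥0 | grDim G (β : ℝ) ≠ 0}.Countable := by
  have hS : S.Countable := by
    have : S = ⋃ n : ℕ, S ∩ Set.Iio (n : ℝ) := by
      ext s
      simp only [Set.mem_iUnion, Set.mem_inter_iff, Set.mem_Iio, exists_and_left]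
      exact ⟨fun h => ⟨h, exists_nat_gt s⟩, fun h => h.1⟩
    rw [this]
    exact Set.countable_iUnion fun n => (hG.finite_jumps n).countable
  refine (hS.preimage NNReal.coe_injective).mono fun β hβ => ?_
  by_contra h
  exact hβ (hG.grDim_eq_zero h)

/-- The codimension of a term is the sum of the dimensions of the graded components below it. -/
theorem codim_eq_tsum (t : ℝ) :
    (codim G t : ℝ≥0∞) = ∑' β : ℝ≥0, if (β : ℝ) < t then grDim G (β : ℝ) else 0 := by
  classical
  induction hn : (S ∩ Set.Iio t).ncard using Nat.strong_induction_on generalizing t with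
  | _ n ih =>
  -- Split off the component at the largest possible jump `s` in `[0, t)`.
  by_cases hpos : ∃ s ∈ S, 0 ≤ s ∧ s < t
  · obtain ⟨s₀, hs₀, h0, hlt⟩ := hpos
    obtain ⟨s, hs, hmax⟩ := (hG.finite_jumps t).exists_maximalFor id _ ⟨s₀, hs₀, hlt⟩
    have hmax' : ∀ u ∈ S, u < t → u ≤ s := fun u hu hut => by
      by_contra h
      exact h (hmax (j := u) ⟨hu, hut⟩ (not_le.1 h).le)
    have hs0 : 0 ≤ s := h0.trans (hmax' _ hs₀ hlt)
    have hcard : (S ∩ Set.Iio s).ncard < n := by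
      rw [← hn]
      refine Set.ncard_lt_ncard ⟨?_, fun h => ?_⟩ (hG.finite_jumps t)
      · exact Set.inter_subset_inter_right _ (Set.Iio_subset_Iio (le_of_lt hs.2))
      · exact lt_irrefl s (h hs).2
    have hgap : ∀ u ∈ S, s < u → t ≤ u := fun u hu hsu => by
      by_contra h
      exact absurd (hmax' u hu (not_le.1 h)) (not_le.2 hsu)
    rw [hG.codim_eq_add_grDim hs.2 hgap, ih _ hcard s rfl]
    have h1 : grDim G s = ∑' β : ℝ≥0, if β = s.toNNReal then grDim G s else 0 := by
      rw [tsum_ite_eq]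
    rw [h1, ← ENNReal.tsum_add]
    refine tsum_congr fun β => ?_
    rcases lt_trichotomy (β : ℝ) s with h | h | h
    · have hne : β ≠ s.toNNReal := fun e => h.ne (by rw [e, Real.coe_toNNReal s hs0])
      rw [if_pos h, if_neg hne, if_pos (h.trans hs.2), add_zero]
    · have he : β = s.toNNReal := NNReal.coe_injective (by rw [h, Real.coe_toNNReal s hs0])
      rw [if_neg h.not_lt, if_pos he, if_pos (h.trans_lt hs.2), zero_add, h]
    · have hne : β ≠ s.toNNReal := fun e => h.ne' (by rw [e, Real.coe_toNNReal s hs0])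
      rw [if_neg h.not_gt, if_neg hne, add_zero]
      split_ifs with hβ
      · exact (hG.grDim_eq_zero fun hmem => (hgap _ hmem h).not_gt hβ).symm
      · rfl
  · push Not at hpos
    have htop : G t = ⊤ := top_le_iff.1 <| (hG.eq_top 0 le_rfl).symm.trans_le
      (hG.le_of_jumps 0 t hpos)
    have hc : codim G t = 0 := by
      unfold codim
      rw [htop]
      exact Module.finrank_zero_of_subsingleton
    rw [hc, Nat.cast_zero, eq_comm, ENNReal.tsum_eq_zero]
    intro β
    split_ifs with hβ
    · exact hG.grDim_eq_zero fun hmem => (hpos _ hmem β.2).not_gt hβ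
    · rfl

end IsDiscreteFiltration

end Filtration

/-! ### Recovering the Hilbert series from the codimensions -/

section Analysis

open MeasureTheory

/-- Sum and integral commute also over an uncountable index type, as long as only countably many
of the functions do not vanish identically. -/
theorem lintegral_tsum_of_countable_support {ι : Type*} {f : ι → ℝ → ℝ≥0∞}
    (hf : ∀ i, Measurable (f i)) (hc : {i | f i ≠ 0}.Countable) :
    ∫⁻ t, ∑' i, f i t = ∑' i, ∫⁻ t, f i t := by
  have := hc.to_subtype
  have h1 : ∀ t, ∑' i, f i t = ∑' i : {i | f i ≠ 0}, f i t := fun t =>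
    (tsum_subtype_eq_of_support_subset fun i hi => by
      intro h0
      exact hi (by simp [h0])).symm
  have h2 : ∑' i, ∫⁻ t, f i t = ∑' i : {i | f i ≠ 0}, ∫⁻ t, f i t :=
    (tsum_subtype_eq_of_support_subset (f := fun i => ∫⁻ t, f i t) fun i hi => by
      intro h0
      exact hi (by simp [h0])).symm
  rw [h2]
  simp_rw [h1]
  exact lintegral_tsum fun i => (hf i).aemeasurable

/-- The density on `ℝ` whose mass on `(s, ∞)` is `z ^ s`, for `0 < z < 1`. -/
noncomputable def expKernel (z t : ℝ) : ℝ≥0∞ := ENNReal.ofReal (-Real.log z * z ^ t)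

theorem measurable_expKernel {z : ℝ} (hz : 0 < z) : Measurable (expKernel z) := by
  unfold expKernel
  have : Continuous fun t : ℝ => -Real.log z * z ^ t :=
    continuous_const.mul (Real.continuous_const_rpow hz.ne')
  exact this.measurable.ennreal_ofReal

theorem lintegral_Ioi_expKernel {z : ℝ} (hz : 0 < z) (hz1 : z < 1) (s : ℝ) :
    ∫⁻ t, (if s < t then expKernel z t else 0) = ENNReal.ofReal (z ^ s) := by
  have hlog := Real.log_neg hz hz1
  have h1 : (fun t => if s < t then expKernel z t else 0)
      = (Set.Ioi s).indicator (expKernel z) := by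
    ext t
    simp [Set.indicator_apply]
  rw [h1, lintegral_indicator measurableSet_Ioi]
  unfold expKernel
  have h2 : ∀ t : ℝ, -Real.log z * z ^ t = -Real.log z * Real.exp (Real.log z * t) :=
    fun t => by rw [Real.rpow_def_of_pos hz]
  simp_rw [h2]
  rw [← ofReal_integral_eq_lintegral_ofReal
    ((integrableOn_exp_mul_Ioi hlog s).const_mul _)
    (Filter.Eventually.of_forall fun t => mul_nonneg (by linarith) (Real.exp_pos _).le),
    integral_const_mul, integral_exp_mul_Ioi hlog, Real.rpow_def_of_pos hz]
  congr 1
  field_simp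
  exact div_self hlog.ne

theorem lintegral_translate_expKernel {z : ℝ} (hz : 0 < z) (D : ℝ → ℝ≥0∞)
    (a : ℝ) :
    ∫⁻ t, D (t - a) * expKernel z t
      = ENNReal.ofReal (z ^ a) * ∫⁻ t, D t * expKernel z t := by
  rw [← lintegral_const_mul' _ _ ENNReal.ofReal_ne_top,
    ← lintegral_sub_right_eq_self (fun t => ENNReal.ofReal (z ^ a) * (D t * expKernel z t)) a]
  refine lintegral_congr fun t => ?_
  have h : expKernel z t = ENNReal.ofReal (z ^ a) * expKernel z (t - a) := by
    unfold expKernel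
    rw [← ENNReal.ofReal_mul (Real.rpow_nonneg hz.le _), Real.rpow_sub hz]
    congr 1
    have := (Real.rpow_pos_of_pos hz a).ne'
    field_simp
  rw [h]
  ring

variable {k : Type*} [Field k] {V : Type*} [Ring V] [Algebra k V] {S : Set ℝ}
  {G : ℝ → Submodule k V}

namespace IsDiscreteFiltration

theorem measurable_codim (hG : IsDiscreteFiltration S G) :
    Measurable fun t => (codim G t : ℝ≥0∞) :=
  Monotone.measurable fun _ _ h => Nat.cast_le.2 (hG.codim_mono h)

/-- For `0 < z < 1` the Hilbert series is the Laplace transform of the codimension function. -/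
theorem lintegral_codim (hG : IsDiscreteFiltration S G) {z : ℝ} (hz : 0 < z) (hz1 : z < 1) :
    ∫⁻ t, (codim G t : ℝ≥0∞) * expKernel z t = hilbertSeries G z := by
  have h1 : ∀ t, (codim G t : ℝ≥0∞) * expKernel z t
      = ∑' β : ℝ≥0, grDim G (β : ℝ) * (if (β : ℝ) < t then expKernel z t else 0) := fun t => by
    rw [hG.codim_eq_tsum, ← ENNReal.tsum_mul_right]
    refine tsum_congr fun β => ?_
    split_ifs <;> simp
  have hm : ∀ β : ℝ≥0, Measurable fun t => if (β : ℝ) < t then expKernel z t else 0 := fun β =>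
    Measurable.ite measurableSet_Ioi (measurable_expKernel hz) measurable_const
  simp_rw [h1]
  rw [lintegral_tsum_of_countable_support (fun β => (hm β).const_mul _)]
  · unfold hilbertSeries
    refine tsum_congr fun β => ?_
    rw [lintegral_const_mul _ (hm β), lintegral_Ioi_expKernel hz hz1]
  · refine hG.countable_support_grDim.mono fun β hβ => ?_
    intro h0
    refine hβ ?_
    ext t
    simp [h0]

/-- At `z = 1` the Hilbert series is the limit of the codimensions. -/
theorem tendsto_codim (hG : IsDiscreteFiltration S G) :
    Filter.Tendsto (fun t => (codim G t : ℝ≥0∞)) Filter.atTop (nhds (hilbertSeries G 1)) := by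
  have hH : hilbertSeries G 1 = ∑' β : ℝ≥0, grDim G (β : ℝ) := by simp [hilbertSeries]
  refine tendsto_atTop_isLUB (fun _ _ h => Nat.cast_le.2 (hG.codim_mono h)) ⟨?_, fun u hu => ?_⟩
  · rintro _ ⟨t, rfl⟩
    simp only
    rw [hH, hG.codim_eq_tsum]
    refine ENNReal.tsum_le_tsum fun β => ?_
    split_ifs <;> simp
  · rw [hH, ENNReal.tsum_eq_iSup_sum]
    refine iSup_le fun T => ?_
    obtain ⟨t, ht⟩ := T.exists_le
    refine le_trans ?_ (hu ⟨(t : ℝ) + 1, rfl⟩)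
    simp only
    rw [hG.codim_eq_tsum]
    refine le_trans (Finset.sum_le_sum fun β hβ => ?_) (ENNReal.sum_le_tsum T)
    have : (β : ℝ) ≤ t := ht β hβ
    rw [if_pos (by linarith)]

end IsDiscreteFiltration

end Analysis

/-! ### Left derivatives by letters and the truncated resolution -/

section Calculus

variable {k : Type*} [Field k] {X : Type*} {F : Type*} [Ring F] [Algebra k F]

/-- What the argument uses of a filtered free algebra, completed or not: the augmentation `aug`
(the constant term), the letters, and for each letter `x` the map `deriv x` that deletes a leading
letter `x` from each word and kills the words with another first letter. The filtration `fil` is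
multiplicative, jumps only at degrees of words, and has terms of finite codimension. -/
structure WordCalculus (d : X → ℝ) (fil : ℝ → Submodule k F) where
  /-- the constant term -/
  aug : F →ₐ[k] k
  /-- the generators -/
  letter : X → F
  /-- the deletion of a leading letter -/
  deriv : X → F →ₗ[k] F
  deriv_mul : ∀ x f g, deriv x (f * g) = deriv x f * g + aug f • deriv x g
  aug_letter : ∀ x, aug (letter x) = 0
  deriv_letter_self : ∀ x, deriv x (letter x) = 1
  deriv_letter_of_ne : ∀ x y, x ≠ y → deriv x (letter y) = 0
  letter_mem : ∀ x, letter x ∈ fil (d x)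
  deriv_mem : ∀ x α f, f ∈ fil α → deriv x f ∈ fil (α - d x)
  aug_eq_zero : ∀ α f, 0 < α → f ∈ fil α → aug f = 0
  mul_mem : ∀ α β f g, f ∈ fil α → g ∈ fil β → f * g ∈ fil (α + β)
  isDiscreteFiltration : IsDiscreteFiltration (Set.range (wordDeg d)) fil

namespace WordCalculus

variable {d : X → ℝ} {fil : ℝ → Submodule k F} (C : WordCalculus d fil)

theorem deriv_letter_mul [DecidableEq X] (x y : X) (f : F) :
    C.deriv x (C.letter y * f) = if x = y then f else 0 := by
  rw [C.deriv_mul, C.aug_letter, zero_smul, add_zero]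
  split_ifs with h
  · rw [h, C.deriv_letter_self, one_mul]
  · rw [C.deriv_letter_of_ne x y h, zero_mul]

/-- The two-sided ideal generated by `R`, as a vector space. -/
def idealSubmodule (k : Type*) [Field k] {F : Type*} [Ring F] [Algebra k F] (R : Set F) :
    Submodule k F :=
  (TwoSidedIdeal.asIdeal (TwoSidedIdeal.span R)).restrictScalars k

theorem mem_idealSubmodule {R : Set F} {f : F} :
    f ∈ idealSubmodule k R ↔ f ∈ TwoSidedIdeal.span R := by
  simp [idealSubmodule]

/-- The map of free right modules `c ↦ (∂ₓ r * c)ₓ` attached to a relation `r`. -/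
def relationMap (r : F) : F →ₗ[k] X → F :=
  LinearMap.pi fun x => LinearMap.mulLeft k (C.deriv x r)

theorem relationMap_apply (r c : F) (x : X) : C.relationMap r c x = C.deriv x r * c := rfl

theorem aug_of_mem_span {R : Set F} (hR : ∀ r ∈ R, C.aug r = 0) {f : F}
    (hf : f ∈ TwoSidedIdeal.span R) : C.aug f = 0 := by
  induction hf using TwoSidedIdeal.span_induction with
  | mem x h => exact hR x h
  | zero => simp
  | add x y _ _ hx hy => simp [hx, hy]
  | neg x _ hx => simp [hx]
  | left_absorb a x _ hx => simp [hx]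
  | right_absorb a x _ hx => simp [hx]

/-- The letter derivatives of an element of the ideal `I` generated by `R` are, modulo `I`,
a right linear combination of the derivatives of the relations: this is exactness at the middle
term of `⨁_R A → ⨁_X A → A`. -/
theorem deriv_mem_of_mem_span {R : Set F} (hR : ∀ r ∈ R, C.aug r = 0) {f : F}
    (hf : f ∈ TwoSidedIdeal.span R) :
    (fun x => C.deriv x f) ∈ Submodule.pi Set.univ (fun _ : X => idealSubmodule k R) ⊔
      ⨆ r ∈ R, LinearMap.range (C.relationMap r) := by
  set L := Submodule.pi Set.univ (fun _ : X => idealSubmodule k R) ⊔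
    ⨆ r ∈ R, LinearMap.range (C.relationMap r)
  have hstable : ∀ h : F, L ≤ L.comap
      (LinearMap.pi fun x => LinearMap.mulRight k h ∘ₗ LinearMap.proj x) := fun h => by
    refine sup_le (fun p hp => ?_) (iSup₂_le fun r hr => ?_)
    · refine Submodule.mem_sup_left fun x _ => ?_
      have := mem_idealSubmodule.1 (hp x trivial)
      exact mem_idealSubmodule.2 (TwoSidedIdeal.mul_mem_right _ _ _ this)
    · rintro _ ⟨c, rfl⟩
      refine Submodule.mem_sup_right (Submodule.mem_iSup_of_mem r
        (Submodule.mem_iSup_of_mem hr ⟨c * h, ?_⟩))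
      ext x
      simp [relationMap_apply, mul_assoc]
  induction hf using TwoSidedIdeal.span_induction with
  | mem r hr =>
    refine Submodule.mem_sup_right (Submodule.mem_iSup_of_mem r
      (Submodule.mem_iSup_of_mem hr ⟨1, ?_⟩))
    ext x
    simp [relationMap_apply]
  | zero =>
    simp only [map_zero]
    exact L.zero_mem
  | add f g _ _ hf hg =>
    simp only [map_add]
    exact L.add_mem hf hg
  | neg f _ hf =>
    simp only [map_neg]
    exact L.neg_mem hf
  | left_absorb a f hfR hf =>
    have h1 : (fun x => C.deriv x (a * f)) =
        (fun x => C.deriv x a * f) + C.aug a • fun x => C.deriv x f := by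
      ext x
      simp [C.deriv_mul]
    rw [h1]
    refine L.add_mem (Submodule.mem_sup_left fun x _ => ?_) (L.smul_mem _ hf)
    exact mem_idealSubmodule.2 (TwoSidedIdeal.mul_mem_left _ _ _ hfR)
  | right_absorb b f hfR hf =>
    have h1 : (fun x => C.deriv x (f * b)) = fun x => C.deriv x f * b := by
      ext x
      simp [C.deriv_mul, C.aug_of_mem_span hR hfR]
    rw [h1]
    exact hstable b hf

theorem aug_eq_zero_of_exists_sub_mem {R : Set F} (hR : ∀ r ∈ R, C.aug r = 0) {α : ℝ}
    (hα : 0 < α) {f : F} (hf : ∃ i ∈ TwoSidedIdeal.span R, f - i ∈ fil α) : C.aug f = 0 := by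
  obtain ⟨i, hi, hu⟩ := hf
  have h0 := C.aug_eq_zero _ _ hα hu
  rwa [map_sub, C.aug_of_mem_span hR hi, sub_zero] at h0

variable [Fintype X]

/-- The Golod–Shafarevich inequality below degree `α`. Here `K α` is the sum of the ideal
generated by `R` and of `fil α`; the finite set `T` of relations contains all those that are not
in `fil α`, and `r ∈ T` is only asked to lie in `fil (a r)`. It is the dimension count for
`⨁_T F / K (α - a r) → ⨁_X F / K (α - d x) → F / K α`, where the kernel of the second map is
contained in the range of the first, and the second map is not surjective. -/
theorem one_add_sum_finrank_le {R : Set F} (hR : ∀ r ∈ R, C.aug r = 0) {K : ℝ → Submodule k F}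
    (hK : ∀ α f, f ∈ K α ↔ ∃ i ∈ TwoSidedIdeal.span R, f - i ∈ fil α) {α : ℝ} (hα : 0 < α)
    (T : Finset F) (hT : ∀ r ∈ R, r ∉ T → r ∈ fil α) (a : F → ℝ)
    (ha : ∀ r ∈ T, r ∈ fil (a r)) :
    1 + ∑ x, Module.finrank k (F ⧸ K (α - d x)) ≤
      Module.finrank k (F ⧸ K α) + ∑ r ∈ T, Module.finrank k (F ⧸ K (α - a r)) := by
  classical
  have hle : ∀ β, fil β ≤ K β := fun β f hf => (hK β f).2 ⟨0, zero_mem _, by simpa using hf⟩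
  have hIK : ∀ β f, f ∈ TwoSidedIdeal.span R → f ∈ K β := fun β f hf =>
    (hK β f).2 ⟨f, hf, by simp⟩
  -- Multiplication on the left by an element of `fil β` shifts the family `K` by `β`.
  have hmul : ∀ β γ f g, f ∈ fil β → g ∈ K (γ - β) → f * g ∈ K γ := fun β γ f g hf hg => by
    obtain ⟨i, hi, hu⟩ := (hK _ _).1 hg
    refine (hK _ _).2 ⟨f * i, TwoSidedIdeal.mul_mem_left _ _ _ hi, ?_⟩
    rw [← mul_sub]
    simpa using C.mul_mem _ _ _ _ hf hu
  have hfin : ∀ β, FiniteDimensional k (F ⧸ K β) := fun β => by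
    have := C.isDiscreteFiltration.finite_codim β
    exact Module.Finite.of_surjective _ (Submodule.factor_surjective (hle β))
  set N : Submodule k (X → F) := Submodule.pi Set.univ fun x => K (α - d x)
  set M : Submodule k (T → F) := Submodule.pi Set.univ fun r : T => K (α - a r)
  have eN := Submodule.quotientPi fun x => K (α - d x)
  have eM := Submodule.quotientPi fun r : T => K (α - a r)
  have : FiniteDimensional k ((X → F) ⧸ N) := Module.Finite.equiv eN.symm
  have : FiniteDimensional k ((T → F) ⧸ M) := Module.Finite.equiv eM.symm
  have hNrank : Module.finrank k ((X → F) ⧸ N) = ∑ x, Module.finrank k (F ⧸ K (α - d x)) := by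
    rw [eN.finrank_eq, Module.finrank_pi_fintype]
  have hMrank : Module.finrank k ((T → F) ⧸ M) =
      ∑ r ∈ T, Module.finrank k (F ⧸ K (α - a r)) := by
    rw [eM.finrank_eq, Module.finrank_pi_fintype,
      ← Finset.sum_coe_sort T fun r => Module.finrank k (F ⧸ K (α - a r))]
  let φ : (X → F) →ₗ[k] F := ∑ x, LinearMap.mulLeft k (C.letter x) ∘ₗ LinearMap.proj x
  have hφ_apply : ∀ p, φ p = ∑ x, C.letter x * p x := fun p => by simp [φ]
  let ψ : (T → F) →ₗ[k] X → F := ∑ r : T, C.relationMap (r : F) ∘ₗ LinearMap.proj r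
  have hφ : N ≤ (K α).comap φ := fun p hp => by
    rw [Submodule.mem_comap, hφ_apply]
    exact Submodule.sum_mem _ fun x _ => hmul _ _ _ _ (C.letter_mem x) (hp x trivial)
  have hψ : M ≤ N.comap ψ := fun g hg => by
    rw [Submodule.mem_comap, LinearMap.sum_apply]
    refine Submodule.sum_mem _ fun r _ x _ => ?_
    refine hmul (a r - d x) _ _ _ (C.deriv_mem _ _ _ (ha r r.2)) ?_
    have : α - d x - (a r - d x) = α - a r := by ring
    rw [this]
    exact hg r trivial
  -- `F / K α` is not exhausted by the multiples of the letters: `1` is missing.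
  have hne : LinearMap.range (N.mapQ (K α) φ hφ) ≠ ⊤ := fun htop => by
    obtain ⟨q, hq⟩ : (K α).mkQ 1 ∈ LinearMap.range (N.mapQ (K α) φ hφ) := htop ▸ trivial
    obtain ⟨p, rfl⟩ := N.mkQ_surjective q
    have hmem : φ p - 1 ∈ K α := (Submodule.Quotient.eq _).1 hq
    have h0 := C.aug_eq_zero_of_exists_sub_mem hR hα ((hK _ _).1 hmem)
    rw [map_sub, hφ_apply] at h0
    simp [C.aug_letter] at h0
  have hker : LinearMap.ker (N.mapQ (K α) φ hφ) ≤ LinearMap.range (M.mapQ N ψ hψ) := by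
    intro q hq
    obtain ⟨p, rfl⟩ := N.mkQ_surjective q
    have hmem : φ p ∈ K α := (Submodule.Quotient.mk_eq_zero _).1 hq
    obtain ⟨i, hi, hu⟩ := (hK _ _).1 hmem
    -- The coordinates `p x` of `φ p = i + u` are the derivatives `∂ₓ i + ∂ₓ u`.
    have hp : p = (fun x => C.deriv x i) + fun x => C.deriv x (φ p - i) := by
      ext x
      simp [hφ_apply, C.deriv_letter_mul]
    have hL : Submodule.pi Set.univ (fun _ : X => idealSubmodule k R) ⊔
        ⨆ r ∈ R, LinearMap.range (C.relationMap r) ≤ N ⊔ LinearMap.range ψ := by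
      refine sup_le (le_sup_of_le_left fun v hv x _ => hIK _ _ (mem_idealSubmodule.1
        (hv x trivial))) (iSup₂_le fun r hr => ?_)
      rintro _ ⟨c, rfl⟩
      by_cases hrT : r ∈ T
      · refine Submodule.mem_sup_right ⟨Pi.single ⟨r, hrT⟩ c, ?_⟩
        rw [LinearMap.sum_apply, Finset.sum_eq_single ⟨r, hrT⟩]
        · simp
        · intro s _ hs
          simp [hs]
        · simp
      · -- A relation of degree at least `α` contributes nothing modulo `N`.
        refine Submodule.mem_sup_left fun x _ => ?_
        refine hmul (α - d x) _ _ _ (C.deriv_mem _ _ _ (hT r hr hrT)) (hle _ ?_)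
        rw [sub_self, C.isDiscreteFiltration.eq_top 0 le_rfl]
        trivial
    have hp' : p ∈ N ⊔ LinearMap.range ψ := by
      rw [hp]
      exact add_mem (hL (C.deriv_mem_of_mem_span hR hi))
        (Submodule.mem_sup_left fun x _ => hle _ (C.deriv_mem _ _ _ hu))
    obtain ⟨n, hn, _, ⟨g, rfl⟩, hsum⟩ := Submodule.mem_sup.1 hp'
    refine ⟨M.mkQ g, ?_⟩
    refine (Submodule.Quotient.eq _).2 ?_
    rw [← hsum, sub_add_cancel_right]
    exact N.neg_mem hn
  have h1 := LinearMap.finrank_range_add_finrank_ker (N.mapQ (K α) φ hφ)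
  have h2 := Submodule.finrank_mono hker
  have h3 := LinearMap.finrank_range_le (M.mapQ N ψ hψ)
  have h4 := Submodule.finrank_lt hne
  rw [← hNrank, ← hMrank]
  omega

end WordCalculus

end Calculus

/-! ### The completed free algebra -/

section Words

variable {X : Type*} {d : X → ℝ}

@[simp] theorem wordDeg_nil : wordDeg d [] = 0 := rfl

@[simp] theorem wordDeg_cons (x : X) (w : List X) : wordDeg d (x :: w) = d x + wordDeg d w := by
  simp [wordDeg]

@[simp] theorem wordDeg_append (v w : List X) :
    wordDeg d (v ++ w) = wordDeg d v + wordDeg d w := by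
  simp [wordDeg]

theorem wordDeg_nonneg (hd : ∀ x, 0 < d x) (w : List X) : 0 ≤ wordDeg d w :=
  List.sum_nonneg fun a ha => by
    obtain ⟨x, _, rfl⟩ := List.mem_map.1 ha
    exact (hd x).le

theorem finite_wordDeg_lt [Finite X] (hd : ∀ x, 0 < d x) (t : ℝ) :
    {w : List X | wordDeg d w < t}.Finite := by
  obtain ⟨ε, hε, hle⟩ : ∃ ε > 0, ∀ x, ε ≤ d x := by
    cases isEmpty_or_nonempty X
    · exact ⟨1, one_pos, isEmptyElim⟩
    · obtain ⟨x₀, h⟩ := Finite.exists_min d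
      exact ⟨d x₀, hd x₀, h⟩
  have hlen : ∀ w : List X, w.length * ε ≤ wordDeg d w := fun w => by
    induction w with
    | nil => simp
    | cons x w ih =>
      have := hle x
      simp only [List.length_cons, Nat.cast_add, Nat.cast_one, wordDeg_cons]
      linarith
  obtain ⟨n, hn⟩ := exists_nat_gt (t / ε)
  refine (List.finite_length_lt X n).subset fun w hw => ?_
  have h1 : (w.length : ℝ) * ε < n * ε :=
    (hlen w).trans_lt (lt_trans hw ((div_lt_iff₀ hε).1 hn))
  exact_mod_cast lt_of_mul_lt_mul_right h1 hε.le

theorem finite_range_wordDeg_inter [Finite X] (hd : ∀ x, 0 < d x) (t : ℝ) :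
    (Set.range (wordDeg d) ∩ Set.Iio t).Finite := by
  refine ((finite_wordDeg_lt hd t).image (wordDeg d)).subset ?_
  rintro _ ⟨⟨w, rfl⟩, hw⟩
  exact ⟨w, hw, rfl⟩

end Words

section Series

variable {k : Type*} [Field k] {X : Type*}

namespace NCSeries

/-- The constant term of a series. -/
def constTerm : NCSeries k X →ₐ[k] k :=
  AlgHom.ofLinearMap
    { toFun := fun f => f.coeff []
      map_add' := fun _ _ => rfl
      map_smul' := fun _ _ => rfl }
    (by simp) (fun f g => by simp [coeff_mul])

/-- The deletion of a leading letter `x`. -/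
def leftDeriv (x : X) : NCSeries k X →ₗ[k] NCSeries k X where
  toFun f := ⟨fun w => f.coeff (x :: w)⟩
  map_add' _ _ := rfl
  map_smul' _ _ := rfl

open Classical in
/-- A generator, as a series. -/
noncomputable def letter (x : X) : NCSeries k X := ⟨fun w => if w = [x] then 1 else 0⟩

theorem leftDeriv_mul (x : X) (f g : NCSeries k X) :
    leftDeriv x (f * g) = leftDeriv x f * g + constTerm f • leftDeriv x g := by
  ext w
  change (f * g).coeff (x :: w) =
    (leftDeriv x f * g).coeff w + f.coeff [] * g.coeff (x :: w)
  rw [coeff_mul, coeff_mul, List.length_cons, Finset.Nat.antidiagonal_succ]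
  simp [leftDeriv, add_comm]

theorem mul_mem_seriesFil {d : X → ℝ} {α β : ℝ} {f g : NCSeries k X} (hf : f ∈ seriesFil d α)
    (hg : g ∈ seriesFil d β) : f * g ∈ seriesFil d (α + β) := fun w hw => by
  rw [coeff_mul]
  refine Finset.sum_eq_zero fun p _ => ?_
  have hsplit : wordDeg d (w.take p.1) + wordDeg d (w.drop p.1) = wordDeg d w := by
    rw [← wordDeg_append, List.take_append_drop]
  rcases lt_or_ge (wordDeg d (w.take p.1)) α with h | h
  · rw [hf _ h, zero_mul]
  · rw [hg _ (by linarith), mul_zero]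

theorem isDiscreteFiltration_seriesFil [Finite X] {d : X → ℝ} (hd : ∀ x, 0 < d x) :
    IsDiscreteFiltration (Set.range (wordDeg d)) (seriesFil (k := k) d) where
  finite_jumps := finite_range_wordDeg_inter hd
  le_of_jumps α β h f hf w hw := by
    refine hf w ?_
    by_contra hα
    exact (h _ ⟨w, rfl⟩ (not_lt.1 hα)).not_gt hw
  eq_top α hα := top_le_iff.1 fun f _ w hw =>
    absurd (hw.trans_le hα) (wordDeg_nonneg hd w).not_gt
  finite_codim α := by
    have := (finite_wordDeg_lt hd α).to_subtype
    let res : NCSeries k X →ₗ[k] ({w : List X | wordDeg d w < α} → k) :=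
      { toFun := fun f w => f.coeff w
        map_add' := fun _ _ => rfl
        map_smul' := fun _ _ => rfl }
    have hker : seriesFil d α = LinearMap.ker res := by
      ext f
      exact ⟨fun h => funext fun w => h w w.2, fun h w hw => congrFun h ⟨w, hw⟩⟩
    rw [hker]
    exact Module.Finite.equiv (LinearMap.quotKerEquivRange res).symm

/-- The calculus of leading letters on the completed free algebra. -/
noncomputable def wordCalculus [Finite X] {d : X → ℝ} (hd : ∀ x, 0 < d x) :
    WordCalculus d (seriesFil (k := k) d) where
  aug := constTerm
  letter := letter
  deriv := leftDeriv
  deriv_mul := leftDeriv_mul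
  aug_letter x := by simp [constTerm, letter]
  deriv_letter_self x := by
    ext w
    simp [leftDeriv, letter]
  deriv_letter_of_ne x y h := by
    ext w
    simp [leftDeriv, letter, h]
  letter_mem x w hw := by
    refine if_neg ?_
    rintro rfl
    simp at hw
  deriv_mem x α f hf w hw := hf (x :: w) (by rw [wordDeg_cons]; linarith)
  aug_eq_zero α f hα hf := hf [] hα
  mul_mem _ _ _ _ := mul_mem_seriesFil
  isDiscreteFiltration := isDiscreteFiltration_seriesFil hd

end NCSeries

end Series

/-! ### The free algebra -/

section Free

variable {k : Type*} [Field k] {X : Type*}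

/-- The element of the free algebra given by a word. -/
noncomputable def wordProd (k : Type*) [Field k] {X : Type*} (w : List X) : FreeAlgebra k X :=
  (w.map (FreeAlgebra.ι k)).prod

@[simp] theorem wordProd_nil : wordProd k ([] : List X) = 1 := rfl

@[simp] theorem wordProd_cons (x : X) (w : List X) :
    wordProd k (x :: w) = FreeAlgebra.ι k x * wordProd k w := by simp [wordProd]

theorem wordProd_append (v w : List X) :
    wordProd k (v ++ w) = wordProd k v * wordProd k w := by simp [wordProd]

theorem wordProd_mem {d : X → ℝ} {α : ℝ} {w : List X} (h : α ≤ wordDeg d w) :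
    wordProd k w ∈ freeFil d α := Submodule.subset_span ⟨w, h, rfl⟩

theorem freeFil_le {d : X → ℝ} {α : ℝ} {P : Submodule k (FreeAlgebra k X)}
    (h : ∀ w, α ≤ wordDeg d w → wordProd k w ∈ P) : freeFil d α ≤ P := by
  refine Submodule.span_le.2 ?_
  rintro _ ⟨w, hw, rfl⟩
  exact h w hw

theorem mul_mem_freeFil {d : X → ℝ} {α β : ℝ} {f g : FreeAlgebra k X} (hf : f ∈ freeFil d α)
    (hg : g ∈ freeFil d β) : f * g ∈ freeFil d (α + β) := by
  refine (freeFil_le (P := (freeFil d (α + β)).comap (LinearMap.mulRight k g))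
    fun v hv => ?_) hf
  refine (freeFil_le (P := (freeFil d (α + β)).comap (LinearMap.mulLeft k (wordProd k v)))
    fun w hw => ?_) hg
  change wordProd k v * wordProd k w ∈ freeFil (k := k) d (α + β)
  rw [← wordProd_append]
  exact wordProd_mem (by rw [wordDeg_append]; exact add_le_add hv hw)

theorem span_range_wordProd : Submodule.span k (Set.range (wordProd k (X := X))) = ⊤ := by
  refine top_le_iff.1 fun f _ => ?_
  induction f using FreeAlgebra.induction with
  | grade0 r =>
    rw [Algebra.algebraMap_eq_smul_one]
    exact Submodule.smul_mem _ _ (Submodule.subset_span ⟨[], rfl⟩)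
  | grade1 x => exact Submodule.subset_span ⟨[x], by simp⟩
  | mul a b ha hb =>
    have := Submodule.mul_mem_mul (ha trivial) (hb trivial)
    rw [Submodule.span_mul_span] at this
    refine Submodule.span_mono ?_ this
    rintro _ ⟨_, ⟨v, rfl⟩, _, ⟨w, rfl⟩, rfl⟩
    exact ⟨v ++ w, wordProd_append v w⟩
  | add a b ha hb => exact add_mem (ha trivial) (hb trivial)

theorem isDiscreteFiltration_freeFil [Finite X] {d : X → ℝ} (hd : ∀ x, 0 < d x) :
    IsDiscreteFiltration (Set.range (wordDeg d)) (freeFil (k := k) d) where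
  finite_jumps := finite_range_wordDeg_inter hd
  le_of_jumps α β h := freeFil_le fun w hw => wordProd_mem (h _ ⟨w, rfl⟩ hw)
  eq_top α hα := by
    rw [← top_le_iff, ← span_range_wordProd, Submodule.span_le]
    rintro _ ⟨w, rfl⟩
    exact wordProd_mem (hα.trans (wordDeg_nonneg hd w))
  finite_codim α := by
    have hfin := ((finite_wordDeg_lt hd α).image (wordProd k)).image (freeFil (k := k) d α).mkQ
    refine ⟨⟨hfin.toFinset, top_le_iff.1 ?_⟩⟩
    rw [Set.Finite.coe_toFinset, ← Submodule.range_mkQ (freeFil d α), LinearMap.range_eq_map,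
      ← span_range_wordProd, Submodule.map_span, Submodule.span_le]
    rintro _ ⟨_, ⟨w, rfl⟩, rfl⟩
    rcases lt_or_ge (wordDeg d w) α with h | h
    · exact Submodule.subset_span ⟨_, ⟨w, h, rfl⟩, rfl⟩
    · have h0 : (freeFil d α).mkQ (wordProd k w) = 0 :=
        (Submodule.Quotient.mk_eq_zero _).2 (wordProd_mem h)
      rw [h0]
      exact zero_mem _

/-- The augmentation of the free algebra. -/
noncomputable def freeAug : FreeAlgebra k X →ₐ[k] k := FreeAlgebra.lift k fun _ => 0

open Classical in
/-- The representation `f ↦ !![aug f, ∂ₓ f; 0, f]` of the free algebra: its multiplicativity is the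
product rule `∂ₓ (f * g) = aug f • ∂ₓ g + ∂ₓ f * g`. -/
noncomputable def derivRep (x : X) :
    FreeAlgebra k X →ₐ[k] Matrix (Fin 2) (Fin 2) (FreeAlgebra k X) :=
  FreeAlgebra.lift k fun y => !![0, if x = y then 1 else 0; 0, FreeAlgebra.ι k y]

theorem derivRep_apply (x : X) (f : FreeAlgebra k X) :
    derivRep x f 0 0 = algebraMap k _ (freeAug f) ∧ derivRep x f 1 0 = 0 ∧
      derivRep x f 1 1 = f := by
  induction f using FreeAlgebra.induction with
  | grade0 r => simp [Matrix.algebraMap_matrix_apply]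
  | grade1 y => simp [derivRep, freeAug]
  | mul a b ha hb => simp [Matrix.mul_apply, ha, hb]
  | add a b ha hb => simp [ha, hb]

/-- The deletion of a leading letter `x` in the free algebra. -/
noncomputable def freeDeriv (x : X) : FreeAlgebra k X →ₗ[k] FreeAlgebra k X where
  toFun f := derivRep x f 0 1
  map_add' f g := by simp
  map_smul' c f := by simp

theorem freeDeriv_mul (x : X) (f g : FreeAlgebra k X) :
    freeDeriv x (f * g) = freeDeriv x f * g + freeAug f • freeDeriv x g := by
  simp [freeDeriv, Matrix.mul_apply, derivRep_apply, Algebra.smul_def, add_comm]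

theorem freeDeriv_ι [DecidableEq X] (x y : X) :
    freeDeriv x (FreeAlgebra.ι k y) = if x = y then 1 else 0 := by
  simp [freeDeriv, derivRep]

/-- The calculus of leading letters on the free algebra. -/
noncomputable def freeWordCalculus [Finite X] {d : X → ℝ} (hd : ∀ x, 0 < d x) :
    WordCalculus d (freeFil (k := k) d) where
  aug := freeAug
  letter := FreeAlgebra.ι k
  deriv := freeDeriv
  deriv_mul := freeDeriv_mul
  aug_letter x := by simp [freeAug]
  deriv_letter_self x := by
    classical
    rw [freeDeriv_ι, if_pos rfl]
  deriv_letter_of_ne x y h := by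
    classical
    rw [freeDeriv_ι, if_neg h]
  letter_mem x := by simpa using wordProd_mem (k := k) (d := d) (w := [x]) (by simp)
  deriv_mem x α f hf := by
    classical
    refine (freeFil_le (P := (freeFil d (α - d x)).comap (freeDeriv x)) fun w hw => ?_) hf
    rw [Submodule.mem_comap]
    cases w with
    | nil =>
      have h1 := freeDeriv_mul (k := k) x 1 1
      simp only [mul_one, map_one, one_smul, left_eq_add] at h1
      rw [wordProd_nil, h1]
      exact zero_mem _
    | cons y w =>
      rw [wordProd_cons, freeDeriv_mul, freeDeriv_ι]
      split_ifs with h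
      · subst h
        rw [wordDeg_cons] at hw
        simpa [freeAug] using wordProd_mem (k := k) (show α - d x ≤ wordDeg d w by linarith)
      · simp [freeAug]
  aug_eq_zero α f hα hf := by
    refine (freeFil_le (P := LinearMap.ker freeAug.toLinearMap) fun w hw => ?_) hf
    cases w with
    | nil => exact absurd hw (by simpa using hα)
    | cons y w => simp [freeAug]
  mul_mem _ _ _ _ := mul_mem_freeFil
  isDiscreteFiltration := isDiscreteFiltration_freeFil hd

end Free

/-! ### Degrees of elements of a filtered algebra -/

section Degree

variable {k : Type*} [Field k] {F : Type*} [Ring F] [Algebra k F] {S : Set ℝ}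
  {fil : ℝ → Submodule k F}

namespace IsDiscreteFiltration

/-- The supremum defining the degree of an element is attained. -/
theorem mem_of_le_filDeg (hG : IsDiscreteFiltration S fil) {α : ℝ} {f : F}
    (h : (α : EReal) ≤ filDeg fil f) : f ∈ fil α := by
  obtain ⟨β, hβ, hgap⟩ : ∃ β < α, ∀ s ∈ S, β < s → α ≤ s := by
    rcases (S ∩ Set.Iio α).eq_empty_or_nonempty with he | hne
    · refine ⟨α - 1, by linarith, fun s hs _ => ?_⟩
      by_contra hlt
      exact (he ▸ ⟨hs, not_le.1 hlt⟩ : s ∈ (∅ : Set ℝ))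
    · obtain ⟨β, hβ, hmax⟩ := (hG.finite_jumps α).exists_maximalFor id _ hne
      refine ⟨β, hβ.2, fun s hs hβs => ?_⟩
      by_contra hlt
      exact (hmax (j := s) ⟨hs, not_le.1 hlt⟩ hβs.le).not_gt hβs
  obtain ⟨_, ⟨γ, rfl, hγ⟩, hlt⟩ := lt_sSup_iff.1 ((EReal.coe_lt_coe_iff.2 hβ).trans_le h)
  exact hG.le_of_jumps γ α (fun s hs hγs =>
    hgap s hs ((EReal.coe_lt_coe_iff.1 hlt).trans_le hγs)) hγ

theorem filDeg_mem_jumps (hG : IsDiscreteFiltration S fil) {α : ℝ} {f : F}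
    (h : filDeg fil f = α) : α ∈ S := by
  by_contra hα
  obtain ⟨β, hαβ, hgap⟩ := exists_gap hG.finite_jumps α
  have hle : fil α ≤ fil β := hG.le_of_jumps _ _ fun s hs hαs =>
    hgap s hs (hαs.lt_of_ne fun e => hα (e ▸ hs))
  have h1 : (β : EReal) ≤ filDeg fil f := le_sSup ⟨β, rfl, hle (hG.mem_of_le_filDeg h.ge)⟩
  rw [h, EReal.coe_le_coe_iff] at h1
  exact h1.not_gt hαβ

theorem finite_filDeg_lt (hG : IsDiscreteFiltration S fil) {R : Set F}
    (hR : IsDiscreteRelations fil R) (t : ℝ) : {r ∈ R | filDeg fil r < t}.Finite := by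
  have hfin := (hG.finite_jumps t).inter_of_left (Set.Ioi 0)
  refine (hfin.biUnion fun s hs => hR.2 s hs.2).subset fun r hr => ?_
  obtain ⟨hrR, hrt⟩ := hr
  have hpos := hR.1 r hrR
  have hcoe : ((filDeg fil r).toReal : EReal) = filDeg fil r :=
    EReal.coe_toReal (hrt.trans (EReal.coe_lt_top t)).ne (bot_le.trans_lt hpos |>.ne')
  rw [← hcoe] at hrt hpos
  exact Set.mem_biUnion ⟨⟨hG.filDeg_mem_jumps hcoe.symm, EReal.coe_lt_coe_iff.1 hrt⟩,
    EReal.coe_pos.1 hpos⟩ ⟨hrR, hcoe.symm⟩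

theorem countable_filDeg_ne_top (hG : IsDiscreteFiltration S fil) {R : Set F}
    (hR : IsDiscreteRelations fil R) : {r ∈ R | filDeg fil r ≠ ⊤}.Countable := by
  refine (Set.countable_iUnion fun n : ℕ =>
    (hG.finite_filDeg_lt hR n).countable).mono fun r hr => ?_
  obtain ⟨n, hn⟩ := exists_nat_gt (filDeg fil r).toReal
  refine Set.mem_iUnion.2 ⟨n, hr.1, ?_⟩
  exact (EReal.le_coe_toReal hr.2).trans_lt (EReal.coe_lt_coe_iff.2 hn)

variable {A : Type*} [Ring A] [Algebra k A] {π : F →ₐ[k] A}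

theorem inducedFil (hG : IsDiscreteFiltration S fil) (hπ : Function.Surjective π) :
    IsDiscreteFiltration S (inducedFil fil π) where
  finite_jumps := hG.finite_jumps
  le_of_jumps α β h := Submodule.map_mono (hG.le_of_jumps α β h)
  eq_top α hα := by
    unfold GolodShafarevich.inducedFil
    rw [hG.eq_top α hα, Submodule.map_top]
    exact LinearMap.range_eq_top.2 hπ
  finite_codim α := by
    have := hG.finite_codim α
    refine Module.Finite.of_surjective ((fil α).mapQ (GolodShafarevich.inducedFil fil π α)
      π.toLinearMap (Submodule.le_comap_map _ _)) fun q => ?_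
    obtain ⟨a, rfl⟩ := Submodule.mkQ_surjective _ q
    obtain ⟨f, rfl⟩ := hπ a
    exact ⟨(fil α).mkQ f, rfl⟩

end IsDiscreteFiltration

theorem codim_eq_finrank_comap {A : Type*} [Ring A] [Algebra k A] {π : F →ₐ[k] A}
    (hπ : Function.Surjective π) (G : ℝ → Submodule k A) (α : ℝ) :
    codim G α = Module.finrank k (F ⧸ (G α).comap π.toLinearMap) := by
  have hker : (G α).comap π.toLinearMap = LinearMap.ker ((G α).mkQ ∘ₗ π.toLinearMap) := by
    rw [LinearMap.ker_comp, Submodule.ker_mkQ]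
  have e := LinearMap.quotKerEquivOfSurjective ((G α).mkQ ∘ₗ π.toLinearMap)
    ((Submodule.mkQ_surjective _).comp hπ)
  exact (((Submodule.quotEquivOfEq _ _ hker).trans e).finrank_eq).symm

end Degree

/-! ### From codimensions to series -/

section Inequality

theorem gsInequality_of_le {x : ℝ} (hx : 0 ≤ x) {ρ H : ℝ≥0∞}
    (h : H ≠ ⊤ → 1 + ENNReal.ofReal x * H ≤ H + ρ * H) :
    GSInequality (1 - (x : EReal) + (ρ : EReal)) H := by
  by_cases hH : H = ⊤
  · exact Or.inl hH
  refine Or.inr ?_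
  specialize h hH
  have hne : H ≠ 0 := by
    rintro rfl
    simp at h
  have h1 : (1 : EReal) - (x : EReal) = ((1 - x : ℝ) : EReal) := by
    rw [EReal.coe_sub, EReal.coe_one]
  rw [h1]
  by_cases hρ : ρ = ⊤
  · rw [hρ, EReal.coe_ennreal_top, EReal.coe_add_top,
      EReal.top_mul_of_pos (by simpa using pos_iff_ne_zero.2 hne)]
    exact le_top
  lift H to ℝ≥0 using hH
  lift ρ to ℝ≥0 using hρ
  lift x to ℝ≥0 using hx
  rw [ENNReal.ofReal_coe_nnreal] at h
  have h' : 1 + (x : ℝ) * H ≤ H + ρ * H := by exact_mod_cast h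
  rw [EReal.coe_nnreal_eq_coe_real, EReal.coe_nnreal_eq_coe_real, ← EReal.coe_add,
    ← EReal.coe_mul, ← EReal.coe_one, EReal.coe_le_coe_iff]
  linarith

variable {k : Type*} [Field k] {X : Type*} [Fintype X] {F : Type*} [Ring F] [Algebra k F]
  {A : Type*} [Ring A] [Algebra k A] {d : X → ℝ} {fil : ℝ → Submodule k F}

/-- The codimension of the term of degree `t - a`, where `a` may be infinite. -/
noncomputable def shiftedCodim (G : ℝ → Submodule k A) (a : EReal) (t : ℝ) : ℝ≥0∞ :=
  if a = ⊤ then 0 else codim G (t - a.toReal)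

namespace WordCalculus

variable (C : WordCalculus d fil) {π : F →ₐ[k] A} {R : Set F}

include C in
/-- The Golod–Shafarevich inequality for codimensions. -/
theorem codim_inequality (hπ : Function.Surjective π)
    (hK : ∀ α f, π f ∈ inducedFil fil π α ↔ ∃ i ∈ TwoSidedIdeal.span R, f - i ∈ fil α)
    (hR : IsDiscreteRelations fil R) (haug : ∀ r ∈ R, C.aug r = 0) {t : ℝ} (ht : 0 < t) :
    (1 + ∑ x, (codim (inducedFil fil π) (t - d x) : ℝ≥0∞)) ≤
      codim (inducedFil fil π) t +
        ∑' r : R, shiftedCodim (inducedFil fil π) (filDeg fil (r : F)) t := by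
  classical
  have hG := C.isDiscreteFiltration
  have hfin := hG.finite_filDeg_lt hR t
  have hT : ∀ r : F, r ∈ hfin.toFinset ↔ r ∈ R ∧ filDeg fil r < t := fun r => by simp
  have key := C.one_add_sum_finrank_le haug
    (K := fun α => (inducedFil fil π α).comap π.toLinearMap) hK ht hfin.toFinset
    (fun r hr hrT => hG.mem_of_le_filDeg (not_lt.1 fun h => hrT ((hT r).2 ⟨hr, h⟩)))
    (fun r => (filDeg fil r).toReal) (fun r hr => hG.mem_of_le_filDeg
      (EReal.coe_toReal_le (bot_le.trans_lt (hR.1 r ((hT r).1 hr).1)).ne'))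
  simp only [← codim_eq_finrank_comap hπ] at key
  have key' : (1 + ∑ x, (codim (inducedFil fil π) (t - d x) : ℝ≥0∞)) ≤
      codim (inducedFil fil π) t + ∑ r ∈ hfin.toFinset,
        (codim (inducedFil fil π) (t - (filDeg fil r).toReal) : ℝ≥0∞) := by exact_mod_cast key
  refine key'.trans (add_le_add le_rfl ?_)
  have hsum : ∑ r ∈ hfin.toFinset,
      (codim (inducedFil fil π) (t - (filDeg fil r).toReal) : ℝ≥0∞) =
      ∑ r ∈ hfin.toFinset.subtype (· ∈ R),
        shiftedCodim (inducedFil fil π) (filDeg fil (r : F)) t := by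
    rw [Finset.sum_subtype_of_mem (fun r => shiftedCodim (inducedFil fil π) (filDeg fil r) t)
      fun r hr => ((hT r).1 hr).1]
    refine Finset.sum_congr rfl fun r hr => ?_
    exact (if_neg (((hT r).1 hr).2.trans (EReal.coe_lt_top t)).ne).symm
  rw [hsum]
  exact ENNReal.sum_le_tsum _

include C in
/-- The Golod–Shafarevich inequality `f_A(z) * H_A(z) ≥ 1`, rearranged so that no subtraction
occurs. For `0 < z < 1` it is the Laplace transform of the inequality for codimensions. -/
theorem series_inequality (hπ : Function.Surjective π)
    (hK : ∀ α f, π f ∈ inducedFil fil π α ↔ ∃ i ∈ TwoSidedIdeal.span R, f - i ∈ fil α)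
    (hd : ∀ x, 0 < d x) (hR : IsDiscreteRelations fil R) {z : ℝ} (hz : z ∈ Set.Icc (0 : ℝ) 1) :
    1 + ENNReal.ofReal (∑ x, z ^ d x) * hilbertSeries (inducedFil fil π) z ≤
      hilbertSeries (inducedFil fil π) z +
        relSeries fil R z * hilbertSeries (inducedFil fil π) z := by
  have hG := C.isDiscreteFiltration
  have hGA := hG.inducedFil hπ
  have haug : ∀ r ∈ R, C.aug r = 0 := fun r hr => by
    obtain ⟨_, ⟨α, rfl, hα⟩, hpos⟩ := lt_sSup_iff.1 (hR.1 r hr)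
    exact C.aug_eq_zero α r (EReal.coe_pos.1 hpos) hα
  have hX : ENNReal.ofReal (∑ x, z ^ d x) = ∑ x, ENNReal.ofReal (z ^ d x) :=
    ENNReal.ofReal_sum_of_nonneg fun x _ => Real.rpow_nonneg hz.1 _
  rcases hz.1.eq_or_lt with rfl | hz0
  · -- At `z = 0` the Hilbert series is the dimension of the component of degree `0`.
    have h0 : ∑ x, (0 : ℝ) ^ d x = 0 :=
      Finset.sum_eq_zero fun x _ => Real.zero_rpow (hd x).ne'
    rw [h0, ENNReal.ofReal_zero, zero_mul, add_zero]
    refine le_add_right ?_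
    obtain ⟨δ, hδ, hgap⟩ := exists_gap hGA.finite_jumps 0
    have hc := hGA.codim_eq_add_grDim hδ hgap
    rw [hGA.codim_of_nonpos le_rfl, Nat.cast_zero, zero_add] at hc
    have hpos : 0 < codim (inducedFil fil π) δ := by
      have := hGA.finite_codim δ
      refine Module.finrank_pos_iff.2 (Submodule.Quotient.nontrivial_iff.2 fun htop => ?_)
      have h1 : π 1 ∈ inducedFil fil π δ := htop ▸ trivial
      have := C.aug_eq_zero_of_exists_sub_mem haug hδ ((hK δ 1).1 h1)
      simp at this
    calc (1 : ℝ≥0∞) ≤ codim (inducedFil fil π) δ := by exact_mod_cast hpos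
      _ = grDim (inducedFil fil π) ((0 : ℝ≥0) : ℝ) * ENNReal.ofReal (0 ^ ((0 : ℝ≥0) : ℝ)) := by
        simp [hc]
      _ ≤ hilbertSeries (inducedFil fil π) 0 :=
        ENNReal.le_tsum (f := fun α : ℝ≥0 =>
          grDim (inducedFil fil π) (α : ℝ) * ENNReal.ofReal (0 ^ (α : ℝ))) 0
  rcases hz.2.eq_or_lt with rfl | hz1
  · -- At `z = 1` let the degree tend to infinity in the inequality for codimensions.
    set H := hilbertSeries (inducedFil fil π) 1
    have hlim := hGA.tendsto_codim
    have hle : ∀ t, (codim (inducedFil fil π) t : ℝ≥0∞) ≤ H :=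
      Monotone.ge_of_tendsto (fun _ _ h => Nat.cast_le.2 (hGA.codim_mono h)) hlim
    have hlim' : Filter.Tendsto
        (fun t => 1 + ∑ x, (codim (inducedFil fil π) (t - d x) : ℝ≥0∞)) Filter.atTop
        (nhds (1 + ∑ _x : X, H)) :=
      (tendsto_finsetSum _ fun x _ =>
        hlim.comp (Filter.tendsto_atTop_add_const_right _ (-d x) Filter.tendsto_id)).const_add _
    have hX' : ENNReal.ofReal (∑ x, (1 : ℝ) ^ d x) * H = ∑ _x : X, H := by
      rw [hX, Finset.sum_mul]
      simp
    rw [hX']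
    refine le_of_tendsto hlim' ((Filter.eventually_gt_atTop 0).mono fun t ht => ?_)
    refine (C.codim_inequality hπ hK hR haug ht).trans (add_le_add (hle t) ?_)
    rw [relSeries, ← ENNReal.tsum_mul_right]
    refine ENNReal.tsum_le_tsum fun r => ?_
    unfold shiftedCodim degPow
    split_ifs
    · simp
    · simpa using hle _
  · have hm := measurable_expKernel hz0
    have hmD : ∀ a : ℝ, Measurable fun t =>
        (codim (inducedFil fil π) (t - a) : ℝ≥0∞) * expKernel z t := fun a =>
      (hGA.measurable_codim.comp (measurable_id.sub_const a)).mul hm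
    have hmD0 : Measurable fun t => (codim (inducedFil fil π) t : ℝ≥0∞) * expKernel z t :=
      hGA.measurable_codim.mul hm
    have hshift : ∀ a : ℝ, ∫⁻ t, (codim (inducedFil fil π) (t - a) : ℝ≥0∞) * expKernel z t =
        ENNReal.ofReal (z ^ a) * hilbertSeries (inducedFil fil π) z := fun a => by
      rw [lintegral_translate_expKernel hz0 fun t => (codim (inducedFil fil π) t : ℝ≥0∞),
        hGA.lintegral_codim hz0 hz1]
    have hrel : ∫⁻ t, ∑' r : R,
        shiftedCodim (inducedFil fil π) (filDeg fil (r : F)) t * expKernel z t =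
        relSeries fil R z * hilbertSeries (inducedFil fil π) z := by
      rw [lintegral_tsum_of_countable_support, relSeries, ← ENNReal.tsum_mul_right]
      · refine tsum_congr fun r => ?_
        unfold shiftedCodim degPow
        split_ifs
        · simp
        · exact hshift _
      · intro r
        unfold shiftedCodim
        split_ifs
        · simp
        · exact hmD _
      · refine ((hG.countable_filDeg_ne_top hR).preimage Subtype.val_injective).mono
          fun r hr => ?_
        refine Set.mem_preimage.2 ⟨r.2, fun htop => hr ?_⟩
        ext t
        simp [shiftedCodim, htop]
    have hleft : ∫⁻ t, ((if 0 < t then expKernel z t else 0) +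
        ∑ x, (codim (inducedFil fil π) (t - d x) : ℝ≥0∞) * expKernel z t) =
        1 + ENNReal.ofReal (∑ x, z ^ d x) * hilbertSeries (inducedFil fil π) z := by
      rw [MeasureTheory.lintegral_add_left
          (Measurable.ite measurableSet_Ioi hm measurable_const),
        MeasureTheory.lintegral_finsetSum _ fun x _ => hmD (d x),
        lintegral_Ioi_expKernel hz0 hz1, hX, Finset.sum_mul]
      simp [hshift]
    rw [← hleft, ← hrel, ← hGA.lintegral_codim hz0 hz1,
      ← MeasureTheory.lintegral_add_left hmD0]
    refine MeasureTheory.lintegral_mono fun t => ?_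
    simp only
    rw [ENNReal.tsum_mul_right, ← Finset.sum_mul, ← add_mul]
    rcases lt_or_ge 0 t with ht | ht
    · rw [if_pos ht]
      calc _ = (1 + ∑ x, (codim (inducedFil fil π) (t - d x) : ℝ≥0∞)) * expKernel z t := by
            rw [add_mul, one_mul]
        _ ≤ _ := mul_le_mul_left (C.codim_inequality hπ hK hR haug ht) _
    · have hz : ∀ x, codim (inducedFil fil π) (t - d x) = 0 := fun x =>
        hGA.codim_of_nonpos (by linarith [hd x])
      simp [hz, ht.not_gt]

include C in
theorem gsInequality (hπ : Function.Surjective π)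
    (hK : ∀ α f, π f ∈ inducedFil fil π α ↔ ∃ i ∈ TwoSidedIdeal.span R, f - i ∈ fil α)
    (hd : ∀ x, 0 < d x) (hR : IsDiscreteRelations fil R) {z : ℝ} (hz : z ∈ Set.Icc (0 : ℝ) 1) :
    GSInequality (gsSeries d fil R z) (hilbertSeries (inducedFil fil π) z) :=
  gsInequality_of_le (Finset.sum_nonneg fun _ _ => Real.rpow_nonneg hz.1 _)
    fun _ => C.series_inequality hπ hK hd hR hz

end WordCalculus

end Inequality

/-! ### Presentations -/

section Presentation

variable {k : Type*} [Field k] {X : Type*} {A : Type*} [Ring A] [Algebra k A] {d : X → ℝ}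

theorem IsPresentation.map_mem_inducedFil_iff {π : FreeAlgebra k X →ₐ[k] A}
    {R : Set (FreeAlgebra k X)} (h : IsPresentation π R) (fil : ℝ → Submodule k (FreeAlgebra k X))
    (α : ℝ) (f : FreeAlgebra k X) :
    π f ∈ inducedFil fil π α ↔ ∃ i ∈ TwoSidedIdeal.span R, f - i ∈ fil α := by
  constructor
  · rintro ⟨u, hu, huf : π u = π f⟩
    exact ⟨f - u, (h.2 _).1 (by rw [map_sub, huf, sub_self]), by simpa using hu⟩
  · rintro ⟨i, hi, hu⟩
    refine ⟨f - i, hu, ?_⟩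
    simp [(h.2 i).2 hi]

/-- Passing to the closure of the ideal generated by `R` does not enlarge its sum with a term of
the filtration, so the description of `A_α` is the same as for the free algebra. -/
theorem IsCompletedPresentation.map_mem_inducedFil_iff {π : NCSeries k X →ₐ[k] A}
    {R : Set (NCSeries k X)} (h : IsCompletedPresentation d π R) (α : ℝ) (f : NCSeries k X) :
    π f ∈ inducedFil (seriesFil d) π α ↔
      ∃ i ∈ TwoSidedIdeal.span R, f - i ∈ seriesFil (k := k) d α := by
  constructor
  · rintro ⟨u, hu, huf : π u = π f⟩
    obtain ⟨g, hg, hfug⟩ := (h.2 (f - u)).1 (by rw [map_sub, huf, sub_self]) α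
    refine ⟨g, hg, ?_⟩
    have := add_mem hfug hu
    rwa [sub_sub, sub_add, add_sub_cancel_left] at this
  · rintro ⟨i, hi, hu⟩
    have hi0 : π i = 0 := (h.2 i).2 fun β => ⟨i, hi, by rw [sub_self]; exact zero_mem _⟩
    refine ⟨f - i, hu, ?_⟩
    simp [hi0]

end Presentation

end GolodShafarevich

theorem mainTheorem3 {k : Type*} [Field k] {X : Type*} [Fintype X] (d : X → ℝ)
    (hd : ∀ x, 0 < d x) {A : Type*} [Ring A] [Algebra k A] :
    (∀ (π : FreeAlgebra k X →ₐ[k] A) (R : Set (FreeAlgebra k X)),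
      GolodShafarevich.IsPresentation π R →
      GolodShafarevich.IsDiscreteRelations (GolodShafarevich.freeFil d) R →
      ∀ z : ℝ, z ∈ Set.Icc (0 : ℝ) 1 →
        GolodShafarevich.GSInequality
          (GolodShafarevich.gsSeries d (GolodShafarevich.freeFil d) R z)
          (GolodShafarevich.hilbertSeries
            (GolodShafarevich.inducedFil (GolodShafarevich.freeFil d) π) z)) ∧
    (∀ (π : GolodShafarevich.NCSeries k X →ₐ[k] A) (R : Set (GolodShafarevich.NCSeries k X)),
      GolodShafarevich.IsCompletedPresentation d π R →
      GolodShafarevich.IsDiscreteRelations (GolodShafarevich.seriesFil d) R →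
      ∀ z : ℝ, z ∈ Set.Icc (0 : ℝ) 1 →
        GolodShafarevich.GSInequality
          (GolodShafarevich.gsSeries d (GolodShafarevich.seriesFil d) R z)
          (GolodShafarevich.hilbertSeries
            (GolodShafarevich.inducedFil (GolodShafarevich.seriesFil d) π) z)) :=
  ⟨fun _ _ hπ hR _ hz => (GolodShafarevich.freeWordCalculus hd).gsInequality hπ.1
      (hπ.map_mem_inducedFil_iff _) hd hR hz,
    fun _ _ hπ hR _ hz => (GolodShafarevich.NCSeries.wordCalculus hd).gsInequality hπ.1
      hπ.map_mem_inducedFil_iff hd hR hz⟩
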